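/- Let $(R,\mathfrak m,k)$ be a commutative noetherian local Cohen--Macaulay ring of Krull dimension $d$ that has a canonical (dualizing) module $\Omega$, i.e. a maximal Cohen--Macaulay module of finite injective dimension with $\dim_k \operatorname{Ext}^d_R(k,\Omega)=1$. Let $\mathsf{MCM}$ be the full subcategory of $R$-modules whose objects are the maximal Cohen--Macaulay modules, that is, the finitely generated $R$-modules $M$ with $\operatorname{depth}_R M\geqslant d$ (where $\operatorname{depth} 0=\infty$). For an additive category $\mathcal A$, a left (respectively, right) $\mathcal A$-module is an additive functor from $\mathcal A$ (respectively, $\mathcal A^{\mathrm{op}}$) to abelian groups. A left $\mathcal A$-module $F$ is finitely presented if there is an exact sequence $\mathcal A(B,-)\to\mathcal A(A,-)\to F\to 0$ with $A,B\in\mathcal A$; finitely presented right $\mathcal A$-modules are the finitely presented left $\mathcal A^{\mathrm{op}}$-modules. The projective dimension of a finitely presented left (right) $\mathcal A$-module $F$ is the smallest $n\geqslant 0$ for which there is an exact sequence $0\to P_n\to\cdots\to P_0\to F\to 0$ whose terms $P_i$ are projective objects of the category of finitely presented left (right) $\mathcal A$-modules, and it is $\infty$ if there is no such $n$; exactness of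 a sequence of functors means exactness at every object. The left (respectively, right) global dimension of $\mathcal A$ is the supremum, in $\mathbb N\cup\{\infty\}$, of the projective dimensions of all finitely presented left (respectively, right) $\mathcal A$-modules. Then the left and right global dimensions of $\mathsf{MCM}$ coincide: $$\operatorname{l.gldim}(\mathsf{MCM})=\operatorname{r.gldim}(\mathsf{MCM}).$$ -/

import Mathlib

open CategoryTheory CategoryTheory.Abelian Opposite

universe u v w

namespace SeveralObjects

/-! ### Modules over a preadditive category ("ring with several objects") -/

section Modules

variable (𝒜 : Type w) [Category.{v} 𝒜] [Preadditive 𝒜]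

/-- Left `𝒜`-modules: additive covariant functors from `𝒜` to abelian groups. -/
abbrev LeftMod := 𝒜 ⥤+ AddCommGrpCat.{v}

/-- A left `𝒜`-module `F` is finitely presented if there is an exact sequence
`𝒜(B, -) ⟶ 𝒜(A, -) ⟶ F ⟶ 0`; exactness of a sequence of functors is exactness at each object.
(This is the definition for additive `𝒜`.) -/
def isFinitelyPresented : ObjectProperty (LeftMod 𝒜) := fun F =>
  ∃ (A B : 𝒜)
    (β : preadditiveCoyoneda.obj (op B) ⟶ preadditiveCoyoneda.obj (op A))
    (π : preadditiveCoyoneda.obj (op A) ⟶ F.obj),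
    (∀ X : 𝒜, Function.Exact (β.app X) (π.app X)) ∧
    (∀ X : 𝒜, Function.Surjective (π.app X))

/-- The category of finitely presented left `𝒜`-modules. -/
abbrev LeftFPMod := (isFinitelyPresented 𝒜).FullSubcategory

variable {𝒜}

/-- The component at `X` of a morphism of finitely presented left `𝒜`-modules. -/
abbrev component {F G : LeftFPMod 𝒜} (f : F ⟶ G) (X : 𝒜) :
    F.obj.obj.obj X ⟶ G.obj.obj.obj X :=
  f.hom.hom.app X

/-- A projective resolution `0 ⟶ P n ⟶ ⋯ ⟶ P 0 ⟶ F ⟶ 0` of length at most `n` in the category of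
finitely presented left `𝒜`-modules: an exact sequence
`⋯ ⟶ P 1 ⟶ P 0 ⟶ F ⟶ 0` whose terms `P i` are projective objects of that category and
vanish for `i > n`. -/
structure ProjRes (F : LeftFPMod 𝒜) (n : ℕ) where
  P : ℕ → LeftFPMod 𝒜
  d : ∀ i : ℕ, P (i + 1) ⟶ P i
  aug : P 0 ⟶ F
  projective : ∀ i : ℕ, Projective (P i)
  isZero : ∀ i : ℕ, n < i → Limits.IsZero (P i)
  exact_d : ∀ (i : ℕ) (X : 𝒜),
    Function.Exact (component (d (i + 1)) X) (component (d i) X)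
  exact_aug : ∀ X : 𝒜, Function.Exact (component (d 0) X) (component aug X)
  surjective_aug : ∀ X : 𝒜, Function.Surjective (component aug X)

/-- The projective dimension of a finitely presented left `𝒜`-module: the length of a shortest
projective resolution (`⊤` if there is no finite one). -/
noncomputable def projDim (F : LeftFPMod 𝒜) : ℕ∞ :=
  ⨅ (n : ℕ) (_ : Nonempty (ProjRes F n)), (n : ℕ∞)

variable (𝒜)

/-- The left global dimension of `𝒜`: the supremum of the projective dimensions of all
finitely presented left `𝒜`-modules. -/
noncomputable def leftGlobalDim : ℕ∞ := ⨆ F : LeftFPMod 𝒜, projDim F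

/-- The right global dimension of `𝒜`. Right `𝒜`-modules are additive covariant functors from
`𝒜ᵒᵖ` to abelian groups, that is, left `𝒜ᵒᵖ`-modules. -/
noncomputable def rightGlobalDim : ℕ∞ := leftGlobalDim 𝒜ᵒᵖ

end Modules

/-! ### Maximal Cohen-Macaulay modules over a local ring -/

section MCM

variable (R : Type u) [CommRing R] [IsLocalRing R]

/-- The depth of a finitely generated module over a noetherian local ring: the supremum of the
lengths of the `M`-regular sequences in the maximal ideal. For `M ≠ 0` the requirement that `M`
modulo the sequence be nonzero is automatic by Nakayama's lemma; leaving it out gives the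
convention `depth 0 = ⊤`. -/
noncomputable def depth (M : Type v) [AddCommGroup M] [Module R M] : ℕ∞ :=
  ⨆ (rs : List R) (_ : (∀ r ∈ rs, r ∈ IsLocalRing.maximalIdeal R) ∧
    RingTheory.Sequence.IsWeaklyRegular M rs), (rs.length : ℕ∞)

/-- A (noetherian) local ring is Cohen-Macaulay if its depth equals its Krull dimension. -/
def IsCohenMacaulayRing : Prop :=
  ((depth R R : ℕ∞) : WithBot ℕ∞) = ringKrullDim R

/-- Maximal Cohen-Macaulay modules: finitely generated modules with `depth M ≥ dim R`. This
includes the zero module; for `M ≠ 0` one always has `depth M ≤ dim R`. -/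
def isMCM : ObjectProperty (ModuleCat.{u} R) := fun M =>
  Module.Finite R M ∧ ringKrullDim R ≤ ((depth R M : ℕ∞) : WithBot ℕ∞)

/-- The category of maximal Cohen-Macaulay `R`-modules, a full subcategory of all `R`-modules. -/
abbrev MCM := (isMCM R).FullSubcategory

variable {R}

/-- A canonical (dualizing) module of a Cohen-Macaulay local ring `(R, 𝔪, k)` of dimension `d`:
a maximal Cohen-Macaulay module of finite injective dimension and of type one, that is,
`Ext^d(k, Ω)` is one-dimensional over `k` (equivalently, has length one over `R`). -/
structure IsCanonicalModule (Ω : ModuleCat.{u} R) : Prop where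
  mcm : isMCM R Ω
  finite_injDim : ∃ n : ℕ, HasInjectiveDimensionLE Ω n
  type_one : ∃ d : ℕ, ringKrullDim R = d ∧
    Module.length R (Ext (ModuleCat.of R (IsLocalRing.ResidueField R)) Ω d) = 1

end MCM

end SeveralObjects

/-!
Let `Ω` be a canonical module of `R`. The functor `D = Hom(-, Ω)` is a duality on the category `MCM`
of maximal Cohen-Macaulay modules, so it identifies `MCMᵒᵖ` with `MCM` as an additive category, and
right `MCM`-modules, being left `MCMᵒᵖ`-modules, are the same as left `MCM`-modules. Since the
global dimension is invariant under additive equivalences (`leftGlobalDim_eq_of_isEquivalence`,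
by restriction of functors), the two global dimensions agree.

The work lies in the duality (`isMCM_hom_and_bijective_applyₗ`): for `M` in `MCM`, the module
`Hom(M, Ω)` is in `MCM` and evaluation `M → Hom(Hom(M, Ω), Ω)` is bijective. Let `d = dim R` and let
`k` be the residue field.

* There is a sequence `x₁, …, x_d` in `𝔪` which is regular on `R` and on `Ω`; as `dim R = d`, the
  ring `R/(x)` is artinian and `k` embeds into it. Since `R/(x)` has projective dimension `d`,
  this embedding forces `Ext^i(-, Ω)` to vanish on finitely generated modules for `i > d`
  (`subsingleton_ext_of_length_lt`).
* Each member of an `M`-regular sequence improves this bound by one, by Nakayama's lemma. Hence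
  `Ext^i(M, Ω) = 0` for `M` in `MCM` and `i ≥ 1` (`subsingleton_ext_of_isWeaklyRegular`).
* This vanishing gives `Hom(M, Ω)/x Hom(M, Ω) ≅ Hom(M, Ω/xΩ)` for `x` regular on `Ω`, so that
  `x₁, …, x_d` is regular on `Hom(M, Ω)` (`isWeaklyRegular_hom`). It also allows reflexivity to be
  lifted one `xᵢ` at a time (`bijective_applyₗ_of_quotSMulTop`).
* This leaves the modules killed by `(x)`, which have finite length. Since
  `Ext^i(k, Ω) = 0` for `i ≠ d` and `Ext^d(k, Ω)` has length one, `Ext^d(N, Ω)` has the length of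
  `N` for all `N` of finite length (`ext_of_isFiniteLength`). If `N` is killed by `(x)`, then
  `Ext^d(N, Ω) ≅ Hom(N, Ω/(x)Ω)`, and counting lengths shows that `N` is reflexive with respect to
  `Ω/(x)Ω` (`bijective_applyₗ_of_length_eq`).
-/

namespace SeveralObjects

/-! ### Vanishing of `Ext` above the dimension -/

section ExtVanishing

open IsLocalRing RingTheory.Sequence Pointwise

variable {R : Type u} [CommRing R]

lemma shortExact_of_exact {M₁ M₂ M₃ : Type u} [AddCommGroup M₁] [Module R M₁] [AddCommGroup M₂]
    [Module R M₂] [AddCommGroup M₃] [Module R M₃] {f : M₁ →ₗ[R] M₂} {g : M₂ →ₗ[R] M₃}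
    (hf : Function.Injective f) (hg : Function.Surjective g) (h : Function.Exact f g) :
    (ModuleCat.shortComplexOfCompEqZero f g h.linearMap_comp_eq_zero).ShortExact :=
  ModuleCat.shortComplex_shortExact _ h hf hg

lemma subsingleton_ext_X₂ {S : ShortComplex (ModuleCat.{u} R)} (hS : S.ShortExact)
    (W : ModuleCat.{u} R) (i : ℕ) [h₁ : Subsingleton (Ext S.X₁ W i)]
    [h₃ : Subsingleton (Ext S.X₃ W i)] : Subsingleton (Ext S.X₂ W i) := by
  refine subsingleton_of_forall_eq 0 fun x ↦ ?_
  obtain ⟨y, rfl⟩ := Ext.contravariant_sequence_exact₂ hS W x (Subsingleton.elim _ _)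
  rw [Subsingleton.elim y 0, Ext.comp_zero]

lemma subsingleton_ext_X₁ {S : ShortComplex (ModuleCat.{u} R)} (hS : S.ShortExact)
    (W : ModuleCat.{u} R) (i : ℕ) [h₂ : Subsingleton (Ext S.X₂ W i)]
    [h₃ : Subsingleton (Ext S.X₃ W (i + 1))] : Subsingleton (Ext S.X₁ W i) := by
  refine subsingleton_of_forall_eq 0 fun x ↦ ?_
  obtain ⟨y, rfl⟩ := Ext.contravariant_sequence_exact₁ hS W x (add_comm 1 i)
    (Subsingleton.elim _ _)
  rw [Subsingleton.elim y 0, Ext.comp_zero]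

lemma subsingleton_ext_to_X₃ {S : ShortComplex (ModuleCat.{u} R)} (hS : S.ShortExact)
    (N : ModuleCat.{u} R) (i : ℕ) [h₂ : Subsingleton (Ext N S.X₂ i)]
    [h₁ : Subsingleton (Ext N S.X₁ (i + 1))] : Subsingleton (Ext N S.X₃ i) := by
  refine subsingleton_of_forall_eq 0 fun x ↦ ?_
  obtain ⟨y, rfl⟩ := Ext.covariant_sequence_exact₃ N hS x rfl (Subsingleton.elim _ _)
  rw [Subsingleton.elim y 0, Ext.zero_comp]

lemma subsingleton_ext_of_linearEquiv {M N : ModuleCat.{u} R} (e : M ≃ₗ[R] N)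
    (W : ModuleCat.{u} R) (i : ℕ) [h : Subsingleton (Ext N W i)] : Subsingleton (Ext M W i) := by
  refine subsingleton_of_forall_eq 0 fun x ↦ ?_
  have : x = (Ext.mk₀ e.toModuleIso.hom).comp ((Ext.mk₀ e.toModuleIso.inv).comp x (zero_add i))
      (zero_add i) := by
    rw [Ext.mk₀_comp_mk₀_assoc, e.toModuleIso.hom_inv_id, Ext.mk₀_id_comp]
  rw [this, Subsingleton.elim ((Ext.mk₀ e.toModuleIso.inv).comp x (zero_add i)) 0, Ext.comp_zero]

lemma subsingleton_ext_of_subsingleton (N : Type u) [AddCommGroup N] [Module R N] [Subsingleton N]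
    (W : ModuleCat.{u} R) (i : ℕ) : Subsingleton (Ext (ModuleCat.of R N) W i) := by
  have : Limits.IsZero (ModuleCat.of R N) := ModuleCat.isZero_of_subsingleton _
  refine subsingleton_of_forall_eq 0 fun x ↦ ?_
  rw [← Ext.mk₀_id_comp x, this.eq_of_src (𝟙 _) 0, Ext.mk₀_zero, Ext.zero_comp]

variable [IsLocalRing R] [IsNoetherianRing R]

/-- If `x` is `M`-regular, multiplication by `x` on `Ext^i(M, W)` has cokernel inside
`Ext^{i+1}(M/xM, W)`; when the latter vanishes, so does `Ext^i(M, W)` by Nakayama's lemma. -/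
lemma subsingleton_ext_of_quotSMulTop (M W : ModuleCat.{u} R) [Module.Finite R M]
    [Module.Finite R W] {x : R} (hx : x ∈ maximalIdeal R) (reg : IsSMulRegular M x) (i : ℕ)
    [h : Subsingleton (Ext (ModuleCat.of R (QuotSMulTop x M)) W (i + 1))] :
    Subsingleton (Ext M W i) := by
  by_contra! ntr
  have mem : x ∈ (Module.annihilator R (Ext M W i)).jacobson := maximalIdeal_le_jacobson _ hx
  refine Submodule.top_ne_pointwise_smul_of_mem_jacobson_annihilator mem ?_
  rw [eq_comm, eq_top_iff]
  intro y _
  obtain ⟨z, hz⟩ := Ext.contravariant_sequence_exact₁ reg.smulShortComplex_shortExact W y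
    (add_comm 1 i) (h.elim _ _)
  have key (z : Ext M W i) : (Ext.mk₀ (x • 𝟙 M)).comp z (zero_add i) = x • z := by
    rw [Ext.mk₀_smul, Ext.smul_comp, Ext.mk₀_id_comp]
  rw [← (key z).symm.trans hz]
  exact Submodule.smul_mem_pointwise_smul _ _ ⊤ trivial

/-- Each element of an `M`-regular sequence lowers by one the bound above which `Ext(M, W)`
vanishes. -/
lemma subsingleton_ext_of_isWeaklyRegular (W : ModuleCat.{u} R) [Module.Finite R W] (d : ℕ)
    (hW : ∀ (N : ModuleCat.{u} R) [Module.Finite R N] (i : ℕ), d < i → Subsingleton (Ext N W i))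
    (rs : List R) (hrs : ∀ r ∈ rs, r ∈ maximalIdeal R) (M : ModuleCat.{u} R) [Module.Finite R M]
    (reg : IsWeaklyRegular M rs) (i : ℕ) (hi : d < i + rs.length) : Subsingleton (Ext M W i) := by
  induction rs generalizing M i with
  | nil => exact hW M i hi
  | cons x rs ih =>
    rw [isWeaklyRegular_cons_iff] at reg
    have := ih (fun r hr ↦ hrs r (List.mem_cons_of_mem _ hr))
      (ModuleCat.of R (QuotSMulTop x M)) reg.2 (i + 1) (by simp at hi; omega)
    exact subsingleton_ext_of_quotSMulTop M W (hrs x List.mem_cons_self) reg.1 i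

/-- If `Ext^{r+1}(-, W)` vanishes on finitely generated modules, then `Ext^r(R/p, W)` vanishes for
all primes `p ≠ 𝔪` by Nakayama's lemma; prime filtrations then reduce the vanishing of
`Ext^r(-, W)` to the residue field. -/
lemma subsingleton_ext_of_residueField (W : ModuleCat.{u} R) [Module.Finite R W] (r : ℕ)
    (hW : ∀ (N : ModuleCat.{u} R) [Module.Finite R N], Subsingleton (Ext N W (r + 1)))
    (hk : Subsingleton (Ext (ModuleCat.of R (ResidueField R)) W r))
    (M : ModuleCat.{u} R) [hM : Module.Finite R M] : Subsingleton (Ext M W r) := by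
  suffices ∀ (M : Type u) [AddCommGroup M] [Module R M] (_ : Module.Finite R M),
      Subsingleton (Ext (ModuleCat.of R M) W r) from this M hM
  intro M _ _ hM
  induction hM using IsNoetherianRing.induction_on_isQuotientEquivQuotientPrime R with
  | subsingleton N => exact subsingleton_ext_of_subsingleton N W r
  | quotient N p e =>
    by_cases hp : p.asIdeal = maximalIdeal R
    · have e' : N ≃ₗ[R] ResidueField R := e.trans (Submodule.quotEquivOfEq _ _ hp)
      exact subsingleton_ext_of_linearEquiv (M := ModuleCat.of R N)
        (N := ModuleCat.of R (ResidueField R)) e' W r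
    · obtain ⟨x, hx, hxp⟩ : ∃ x ∈ maximalIdeal R, x ∉ p.asIdeal := by
        by_contra! h
        exact hp ((le_maximalIdeal p.2.ne_top).antisymm h)
      have reg : IsSMulRegular N x := by
        refine IsSMulRegular.of_injective e e.injective ?_
        rw [isSMulRegular_iff_right_eq_zero_of_smul]
        intro y hy
        obtain ⟨y, rfl⟩ := Ideal.Quotient.mk_surjective y
        rw [← Ideal.Quotient.mkₐ_eq_mk R, ← map_smul, Ideal.Quotient.mkₐ_eq_mk,
          Ideal.Quotient.eq_zero_iff_mem, smul_eq_mul] at hy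
        exact Ideal.Quotient.eq_zero_iff_mem.2 ((p.2.mem_or_mem hy).resolve_left hxp)
      have := hW (ModuleCat.of R (QuotSMulTop x (ModuleCat.of R N)))
      exact subsingleton_ext_of_quotSMulTop (ModuleCat.of R N) W hx reg r
  | exact N₁ N₂ N₃ f g hf hg hfg h₁ h₃ =>
    exact subsingleton_ext_X₂ (shortExact_of_exact hf hg hfg) W r

/-- A module of finite injective dimension has injective dimension (tested on finitely generated
modules) at most the length of any regular sequence `rs` such that the residue field embeds into
`R/(rs)`: above that length `Ext(R/(rs), -)` vanishes, hence so does the top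
nonvanishing `Ext^r(k, -)`, because `Ext^r(-, W)` is right exact there. -/
lemma subsingleton_ext_of_length_lt (W : ModuleCat.{u} R) [Module.Finite R W]
    (hW : ∃ n : ℕ, HasInjectiveDimensionLE W n) (rs : List R) (reg : IsRegular R rs)
    (f : ResidueField R →ₗ[R] R ⧸ Ideal.ofList rs) (hf : Function.Injective f)
    (M : ModuleCat.{u} R) [Module.Finite R M] (i : ℕ) (hi : rs.length < i) :
    Subsingleton (Ext M W i) := by
  obtain ⟨n, hn⟩ := hW
  suffices ∀ (j : ℕ), ∀ i, rs.length < i → n < i + j → ∀ (M : ModuleCat.{u} R) [Module.Finite R M],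
      Subsingleton (Ext M W i) from this (n + 1) i hi (by omega) M
  -- Descend from the injective dimension of `W` to the length of `rs`.
  intro j
  induction j with
  | zero => exact fun i _ hi M _ ↦ HasInjectiveDimensionLT.subsingleton W (n + 1) i hi M
  | succ j ih =>
    intro i hi hij M _
    have hi1 := ih (i + 1) (by omega) (by omega)
    refine subsingleton_ext_of_residueField W i hi1 ?_ M
    have pd : projectiveDimension (ModuleCat.of R (R ⧸ Ideal.ofList rs)) = rs.length := by
      rw [← ModuleCat.projectiveDimension_quotient_eq_length.{u} rs reg]
      exact projectiveDimension_eq_of_iso (Shrink.linearEquiv R _).symm.toModuleIso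
    have : HasProjectiveDimensionLE (ModuleCat.of R (R ⧸ Ideal.ofList rs)) rs.length := by
      rw [← projectiveDimension_le_iff, pd]
    have h₂ := HasProjectiveDimensionLT.subsingleton (ModuleCat.of R (R ⧸ Ideal.ofList rs))
      (rs.length + 1) i hi W
    have h₃ := hi1 (ModuleCat.of R ((R ⧸ Ideal.ofList rs) ⧸ LinearMap.range f))
    exact subsingleton_ext_X₁ (shortExact_of_exact hf (Submodule.mkQ_surjective _)
      (LinearMap.exact_map_mkQ_range f)) W i

end ExtVanishing

/-! ### Regular sequences and reflexivity -/

section Duality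

open IsLocalRing RingTheory.Sequence Pointwise

variable {R : Type u} [CommRing R]

lemma exists_mkQ_comp_eq (M W : ModuleCat.{u} R) {x : R} (reg : IsSMulRegular W x)
    [h : Subsingleton (Ext M W 1)] (φ : M →ₗ[R] QuotSMulTop x W) :
    ∃ ψ : M →ₗ[R] W, (x • (⊤ : Submodule R W)).mkQ ∘ₗ ψ = φ := by
  obtain ⟨y, hy⟩ := Ext.covariant_sequence_exact₃ M reg.smulShortComplex_shortExact
    (Ext.mk₀ (ModuleCat.ofHom φ)) (zero_add 1) (h.elim _ _)
  obtain ⟨ψ, rfl⟩ := (Ext.mk₀_bijective _ _).2 y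
  rw [Ext.mk₀_comp_mk₀] at hy
  have := (Ext.mk₀_bijective _ _).1 hy
  exact ⟨ψ.hom, congrArg ModuleCat.Hom.hom this⟩

lemma subsingleton_ext_quotSMulTop (M W : ModuleCat.{u} R) {x : R} (reg : IsSMulRegular W x)
    (h : ∀ i, Subsingleton (Ext M W (i + 1))) (i : ℕ) :
    Subsingleton (Ext M (ModuleCat.of R (QuotSMulTop x W)) (i + 1)) :=
  subsingleton_ext_to_X₃ reg.smulShortComplex_shortExact M (i + 1) (h₂ := h i) (h₁ := h (i + 1))

lemma mem_smul_top_hom_iff {M W : Type*} [AddCommGroup M] [Module R M] [AddCommGroup W]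
    [Module R W] {x : R} (reg : IsSMulRegular W x) (φ : M →ₗ[R] W) :
    φ ∈ x • (⊤ : Submodule R (M →ₗ[R] W)) ↔ ∀ m, φ m ∈ x • (⊤ : Submodule R W) := by
  simp only [Submodule.mem_smul_pointwise_iff_exists]
  constructor
  · rintro ⟨ψ, -, rfl⟩ m
    exact ⟨ψ m, trivial, rfl⟩
  · intro h
    choose ψ _ hψ using h
    refine ⟨⟨⟨ψ, fun a b ↦ reg ?_⟩, fun r a ↦ reg ?_⟩, trivial, LinearMap.ext hψ⟩
    · simp [hψ]
    · simp [hψ, smul_comm x r]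

/-- If `x` is `W`-regular and every linear map `M → W/xW` lifts to `W`, then
`Hom(M, W)/x Hom(M, W) ≅ Hom(M, W/xW)`. -/
noncomputable def quotSMulTopHomEquiv {M W : Type*} [AddCommGroup M] [Module R M] [AddCommGroup W]
    [Module R W] {x : R} (reg : IsSMulRegular W x)
    (lift : ∀ φ : M →ₗ[R] QuotSMulTop x W, ∃ ψ : M →ₗ[R] W,
      (x • (⊤ : Submodule R W)).mkQ ∘ₗ ψ = φ) :
    QuotSMulTop x (M →ₗ[R] W) ≃ₗ[R] (M →ₗ[R] QuotSMulTop x W) :=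
  (Submodule.quotEquivOfEq _ _ (by
    ext φ
    rw [LinearMap.mem_ker, mem_smul_top_hom_iff reg, LinearMap.ext_iff]
    exact forall_congr' fun m ↦ (Submodule.Quotient.mk_eq_zero _).symm)).trans
  (((x • (⊤ : Submodule R W)).mkQ.compRight R (M := M)).quotKerEquivOfSurjective lift)

@[simp]
lemma quotSMulTopHomEquiv_mk {M W : Type*} [AddCommGroup M] [Module R M] [AddCommGroup W]
    [Module R W] {x : R} (reg : IsSMulRegular W x)
    (lift : ∀ φ : M →ₗ[R] QuotSMulTop x W, ∃ ψ : M →ₗ[R] W,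
      (x • (⊤ : Submodule R W)).mkQ ∘ₗ ψ = φ) (ψ : M →ₗ[R] W) :
    quotSMulTopHomEquiv reg lift (Submodule.Quotient.mk ψ) =
      (x • (⊤ : Submodule R W)).mkQ ∘ₗ ψ := rfl

/-- Under the vanishing of `Ext^i(M, W)` for `i ≥ 1`, every `W`-regular sequence is
`Hom(M, W)`-regular. -/
lemma isWeaklyRegular_hom (rs : List R) (M W : ModuleCat.{u} R) (reg : IsWeaklyRegular W rs)
    (h : ∀ i, Subsingleton (Ext M W (i + 1))) : IsWeaklyRegular (M →ₗ[R] W) rs := by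
  induction rs generalizing W with
  | nil => exact .nil R _
  | cons x rs ih =>
    rw [isWeaklyRegular_cons_iff] at reg ⊢
    refine ⟨fun φ ψ h ↦ LinearMap.ext fun m ↦ reg.1 (LinearMap.congr_fun h m), ?_⟩
    have := h 0
    rw [(quotSMulTopHomEquiv reg.1 (exists_mkQ_comp_eq M W reg.1)).isWeaklyRegular_congr]
    exact ih (ModuleCat.of R (QuotSMulTop x W)) reg.2 (subsingleton_ext_quotSMulTop M W reg.1 h)

lemma isArtinian_of_le_annihilator [IsNoetherianRing R] {J : Ideal R}
    [IsArtinianRing (R ⧸ J)] (N : Type u) [AddCommGroup N] [Module R N] [Module.Finite R N]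
    (hN : J ≤ Module.annihilator R N) : IsArtinian R N := by
  have tors : Module.IsTorsionBySet R N J := fun n a ↦ Module.mem_annihilator.1 (hN a.2) n
  let : Module (R ⧸ J) N := tors.module
  have : IsScalarTower R (R ⧸ J) N := tors.isScalarTower
  have : Module.Finite (R ⧸ J) N := Module.Finite.of_restrictScalars_finite R _ _
  exact isArtinian_of_surjective_algebraMap (S := R) (R := R ⧸ J) (M := N)
    Ideal.Quotient.mk_surjective

lemma le_annihilator_hom {J : Ideal R} (M W : Type*) [AddCommGroup M] [Module R M]
    [AddCommGroup W] [Module R W] (hM : J ≤ Module.annihilator R M) :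
    J ≤ Module.annihilator R (M →ₗ[R] W) := fun r hr ↦
  Module.mem_annihilator.2 fun φ ↦ by
    ext m
    rw [LinearMap.smul_apply, ← map_smul, Module.mem_annihilator.1 (hM hr), map_zero,
      LinearMap.zero_apply]

/-- If `Hom(-, W)` preserves the length of modules killed by `J`, where `R/J` is artinian, then
such modules are `W`-reflexive: an element killed by all functionals could be divided out without
changing the length of the dual, and a comparison of lengths gives surjectivity. -/
lemma bijective_applyₗ_of_length_eq [IsNoetherianRing R] {J : Ideal R} [IsArtinianRing (R ⧸ J)]
    (W : Type u) [AddCommGroup W] [Module R W] [Module.Finite R W]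
    (hW : ∀ (N : Type u) [AddCommGroup N] [Module R N] [Module.Finite R N],
      J ≤ Module.annihilator R N → Module.length R (N →ₗ[R] W) = Module.length R N)
    (M : Type u) [AddCommGroup M] [Module R M] [Module.Finite R M]
    (hM : J ≤ Module.annihilator R M) :
    Function.Bijective (LinearMap.applyₗ : M →ₗ[R] (M →ₗ[R] W) →ₗ[R] W) := by
  have := isArtinian_of_le_annihilator M hM
  have inj : Function.Injective (LinearMap.applyₗ : M →ₗ[R] (M →ₗ[R] W) →ₗ[R] W) := by
    rw [injective_iff_map_eq_zero]
    intro m hm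
    have e : ((M ⧸ R ∙ m) →ₗ[R] W) ≃ₗ[R] (M →ₗ[R] W) := by
      refine LinearEquiv.ofBijective (LinearMap.lcomp R W (R ∙ m).mkQ)
        ⟨fun f g h ↦ Submodule.linearMap_qext _ h, fun f ↦ ?_⟩
      have hf : R ∙ m ≤ LinearMap.ker f := by
        rw [Submodule.span_singleton_le_iff_mem]
        exact LinearMap.congr_fun hm f
      exact ⟨(R ∙ m).liftQ f hf, Submodule.liftQ_mkQ _ f hf⟩
    have hS := hW (M ⧸ R ∙ m)
      (hM.trans (LinearMap.annihilator_le_of_surjective _ (Submodule.mkQ_surjective _)))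
    rw [e.length_eq, hW M hM] at hS
    by_contra hm0
    exact (Submodule.length_quotient_lt (R ∙ m) (by simpa using hm0)).ne hS.symm
  have hdual := le_annihilator_hom M W hM
  have hlen := (hW _ hdual).trans (hW M hM)
  have := isArtinian_of_le_annihilator _ (le_annihilator_hom (M →ₗ[R] W) W hdual)
  refine ⟨inj, LinearMap.range_eq_top.1 ?_⟩
  by_contra hne
  exact (Submodule.length_lt hne).ne
    ((LinearEquiv.ofInjective _ inj).length_eq.symm.trans hlen.symm)

/-- Reflexivity lifts along a `W`-regular element `x`. Injectivity: an element `m` killed by all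
functionals is `x m'` for some `m'`, which is again killed by all functionals. Surjectivity: modulo
`x`, an element of the bidual of `M` descends to the bidual of `M/xM` over `W/xW`, where it is an
evaluation. Nakayama's lemma concludes in both cases. -/
lemma bijective_applyₗ_of_quotSMulTop [IsLocalRing R] [IsNoetherianRing R]
    {M W : Type*} [AddCommGroup M] [Module R M] [AddCommGroup W]
    [Module R W] [Module.Finite R M] [Module.Finite R W] {x : R} (hx : x ∈ maximalIdeal R)
    (reg : IsSMulRegular W x)
    (lift : ∀ φ : M →ₗ[R] QuotSMulTop x W, ∃ ψ : M →ₗ[R] W,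
      (x • (⊤ : Submodule R W)).mkQ ∘ₗ ψ = φ)
    (h : Function.Bijective (LinearMap.applyₗ : QuotSMulTop x M →ₗ[R]
      (QuotSMulTop x M →ₗ[R] QuotSMulTop x W) →ₗ[R] QuotSMulTop x W)) :
    Function.Bijective (LinearMap.applyₗ : M →ₗ[R] (M →ₗ[R] W) →ₗ[R] W) := by
  have hjac : R ∙ x ≤ Ideal.jacobson ⊥ := by
    rw [jacobson_eq_maximalIdeal _ bot_ne_top, Submodule.span_singleton_le_iff_mem]
    exact hx
  constructor
  · rw [← LinearMap.ker_eq_bot]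
    refine Submodule.eq_bot_of_le_smul_of_le_jacobson_bot (R ∙ x) _ (IsNoetherian.noetherian _)
      (fun m hm ↦ ?_) hjac
    have hm' (ψ : M →ₗ[R] W) : ψ m = 0 := LinearMap.congr_fun hm ψ
    have h0 : (Submodule.Quotient.mk m : QuotSMulTop x M) = 0 := by
      refine h.1 (LinearMap.ext fun g ↦ ?_)
      obtain ⟨ψ, hψ⟩ := lift (g ∘ₗ (x • (⊤ : Submodule R M)).mkQ)
      rw [map_zero, LinearMap.zero_apply]
      exact (LinearMap.congr_fun hψ m).symm.trans (by simp [hm'])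
    obtain ⟨m', -, rfl⟩ := (Submodule.mem_smul_pointwise_iff_exists _ _ _).1
      ((Submodule.Quotient.mk_eq_zero _).1 h0)
    refine Submodule.smul_mem_smul (Submodule.mem_span_singleton_self x) ?_
    refine LinearMap.ext fun ψ ↦ reg ?_
    have := hm' ψ
    rw [map_smul] at this
    simpa using this
  · rw [← LinearMap.range_eq_top, eq_top_iff]
    refine Submodule.le_of_le_smul_of_le_jacobson_bot (I := R ∙ x) (IsNoetherian.noetherian _)
      hjac ?_
    intro f _
    -- `f` modulo `x` is a map `Hom(M, W)/x Hom(M, W) → W/xW`; compose it with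
    -- `Hom(M/xM, W/xW) → Hom(M, W/xW) ≅ Hom(M, W)/x Hom(M, W)`.
    obtain ⟨m, hm⟩ := h.2 (QuotSMulTop.map x f ∘ₗ (quotSMulTopHomEquiv reg lift).symm.toLinearMap ∘ₗ
      LinearMap.lcomp R _ (x • (⊤ : Submodule R M)).mkQ)
    obtain ⟨m, rfl⟩ := Submodule.Quotient.mk_surjective _ m
    rw [← add_sub_cancel (LinearMap.applyₗ m) f]
    refine Submodule.add_mem_sup ⟨m, rfl⟩ ?_
    rw [Submodule.ideal_span_singleton_smul, mem_smul_top_hom_iff reg]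
    intro ψ
    have := LinearMap.congr_fun hm (QuotSMulTop.map x ψ)
    have e : (quotSMulTopHomEquiv reg lift).symm
        (QuotSMulTop.map x ψ ∘ₗ (x • (⊤ : Submodule R M)).mkQ) = Submodule.Quotient.mk ψ := by
      rw [LinearEquiv.symm_apply_eq, quotSMulTopHomEquiv_mk]
      rfl
    rw [LinearMap.comp_apply, LinearMap.comp_apply, LinearMap.lcomp_apply',
      LinearEquiv.coe_coe, e] at this
    exact (Submodule.Quotient.eq _).1 this.symm

/-- If `x` is `W`-regular, kills `N`, and `Ext^n(N, W) = 0`, then the connecting map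
`Ext^n(N, W/xW) → Ext^{n+1}(N, W)` is an isomorphism, multiplication by `x` on the target
being zero. -/
lemma bijective_postcomp_extClass {N W : ModuleCat.{u} R} {x : R} (reg : IsSMulRegular W x)
    (hN : x ∈ Module.annihilator R N) (n : ℕ) [h : Subsingleton (Ext N W n)] :
    Function.Bijective (Ext.postcompOfLinear reg.smulShortComplex_shortExact.extClass R N
      (rfl : n + 1 = n + 1)) := by
  constructor
  · rw [injective_iff_map_eq_zero]
    intro y hy
    obtain ⟨z, rfl⟩ := Ext.covariant_sequence_exact₃ N reg.smulShortComplex_shortExact y rfl hy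
    have h' : Subsingleton (Ext N (W.smulShortComplex x).X₂ n) := h
    rw [h'.elim z 0, Ext.zero_comp]
  · intro y
    refine Ext.covariant_sequence_exact₁ N reg.smulShortComplex_shortExact y ?_ rfl
    exact DFunLike.congr_fun (congrArg AddCommGrpCat.Hom.hom
      (Ext.postcomp_smul_id_eq_zero_of_mem_annihilator (M := W) hN (n + 1))) y

/-- Reflexivity of `M` with respect to `W` by induction along a `W`-regular sequence. `M` is a
quotient of a module `M₀` with `Ext^i(M₀, W) = 0` for `i ≥ 1` through which all maps `M₀ → W`
factor: this makes maps out of `M` liftable at every stage, without passing to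
quotient rings. When the sequence is used up, `M` is killed by `J`, and the hypothesis
on `Ext(-, W)` says that `Hom(-, W)` preserves the length of modules killed by `J`. -/
lemma bijective_applyₗ_of_isWeaklyRegular [IsLocalRing R] [IsNoetherianRing R] {J : Ideal R}
    [IsArtinianRing (R ⧸ J)] (M₀ : ModuleCat.{u} R) (rs : List R)
    (hrs : ∀ r ∈ rs, r ∈ maximalIdeal R) (hrsJ : ∀ r ∈ rs, r ∈ J)
    (W M : ModuleCat.{u} R) [Module.Finite R W] [Module.Finite R M] (reg : IsWeaklyRegular W rs)
    (hlow : ∀ (N : ModuleCat.{u} R) [Module.Finite R N], J ≤ Module.annihilator R N →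
      ∀ i < rs.length, Subsingleton (Ext N W i))
    (hlen : ∀ (N : ModuleCat.{u} R) [Module.Finite R N], J ≤ Module.annihilator R N →
      Module.length R (Ext N W rs.length) = Module.length R N)
    (hM₀ : ∀ i, Subsingleton (Ext M₀ W (i + 1))) (p : M₀ →ₗ[R] M) (hp : Function.Surjective p)
    (hfac : ∀ φ : M₀ →ₗ[R] W, ∃ ψ : M →ₗ[R] W, ψ ∘ₗ p = φ)
    (hJ : J ≤ Ideal.ofList rs ⊔ Module.annihilator R M) :
    Function.Bijective (LinearMap.applyₗ : M →ₗ[R] (M →ₗ[R] W) →ₗ[R] W) := by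
  induction rs generalizing W M with
  | nil =>
    rw [Ideal.ofList_nil, bot_sup_eq] at hJ
    refine bijective_applyₗ_of_length_eq W (fun N _ _ _ hN ↦ ?_) M hJ
    rw [← hlen (ModuleCat.of R N) hN]
    exact (Ext.linearEquiv₀.trans ModuleCat.homLinearEquiv :
      Ext (ModuleCat.of R N) W 0 ≃ₗ[R] (N →ₗ[R] W)).length_eq.symm
  | cons x rs ih =>
    rw [isWeaklyRegular_cons_iff] at reg
    have lift₀ := have := hM₀ 0; exists_mkQ_comp_eq M₀ W reg.1
    have lift (φ : M →ₗ[R] QuotSMulTop x W) : ∃ ψ : M →ₗ[R] W,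
        (x • (⊤ : Submodule R W)).mkQ ∘ₗ ψ = φ := by
      obtain ⟨ψ, hψ⟩ := lift₀ (φ ∘ₗ p)
      obtain ⟨ψ, rfl⟩ := hfac ψ
      exact ⟨ψ, LinearMap.cancel_right hp |>.1 (by rw [← hψ, LinearMap.comp_assoc])⟩
    have hxJ := hrsJ x List.mem_cons_self
    refine bijective_applyₗ_of_quotSMulTop (hrs x List.mem_cons_self) reg.1 lift ?_
    refine ih (fun r hr ↦ hrs r (List.mem_cons_of_mem _ hr))
      (fun r hr ↦ hrsJ r (List.mem_cons_of_mem _ hr)) (ModuleCat.of R (QuotSMulTop x W))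
      (ModuleCat.of R (QuotSMulTop x M)) reg.2 (fun N _ hN i hi ↦ ?_) (fun N _ hN ↦ ?_)
      (subsingleton_ext_quotSMulTop M₀ W reg.1 hM₀) ((x • (⊤ : Submodule R M)).mkQ ∘ₗ p)
      ((Submodule.mkQ_surjective _).comp hp) (fun φ ↦ ?_) ?_
    · have h₂ := hlow N hN i (by simp; omega)
      have h₁ := hlow N hN (i + 1) (by simpa using hi)
      exact subsingleton_ext_to_X₃ reg.1.smulShortComplex_shortExact N i (h₂ := h₂) (h₁ := h₁)
    · have := hlow N hN rs.length (by simp)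
      rw [← hlen N hN]
      exact (LinearEquiv.ofBijective _
        (bijective_postcomp_extClass reg.1 (hN hxJ) rs.length)).length_eq
    · obtain ⟨ψ, rfl⟩ := lift₀ φ
      obtain ⟨ψ, rfl⟩ := hfac ψ
      exact ⟨QuotSMulTop.map x ψ, rfl⟩
    · refine hJ.trans ?_
      rw [Ideal.ofList_cons, sup_comm (Ideal.span {x}), sup_assoc]
      refine sup_le_sup_left (sup_le ?_ ?_) _
      · rw [Ideal.span_singleton_le_iff_mem]
        exact QuotSMulTop.mem_annihilator M x
      · exact LinearMap.annihilator_le_of_surjective _ (Submodule.mkQ_surjective _)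

/-- If `Ext^i(k, W)` vanishes for `i < d` and `i = d + 1` and has length one for `i = d`, then
`Ext^i(N, W) = 0` for `i < d` and `Ext^d(N, W)` has the length of `N`, for all `N` of finite
length: this is additive along a composition series. -/
lemma ext_of_isFiniteLength [IsLocalRing R] [IsNoetherianRing R] (W : ModuleCat.{u} R) (d : ℕ)
    (hlow : ∀ i < d, Subsingleton (Ext (ModuleCat.of R (ResidueField R)) W i))
    (hlen : Module.length R (Ext (ModuleCat.of R (ResidueField R)) W d) = 1)
    (hhigh : Subsingleton (Ext (ModuleCat.of R (ResidueField R)) W (d + 1)))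
    (N : Type u) [AddCommGroup N] [Module R N] (hN : IsFiniteLength R N) :
    (∀ i < d, Subsingleton (Ext (ModuleCat.of R N) W i)) ∧
      Module.length R (Ext (ModuleCat.of R N) W d) = Module.length R N := by
  induction hN with
  | @of_subsingleton N =>
    have h0 := subsingleton_ext_of_subsingleton N W
    exact ⟨fun i _ ↦ h0 i, by rw [Module.length_eq_zero_iff.2 (h0 d), Module.length_eq_zero]⟩
  | @of_simple_quotient M _ _ N _ hN ih =>
    obtain ⟨I, hI, ⟨e⟩⟩ := isSimpleModule_iff_quot_maximal.1 ‹IsSimpleModule R (M ⧸ N)›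
    obtain rfl := eq_maximalIdeal hI
    let f : M →ₗ[R] ResidueField R := e.toLinearMap ∘ₗ N.mkQ
    have hf : Function.Surjective f := e.surjective.comp N.mkQ_surjective
    have hex : Function.Exact N.subtype f := fun y ↦
      e.map_eq_zero_iff.trans (LinearMap.exact_subtype_mkQ N y)
    have hS := shortExact_of_exact N.subtype_injective hf hex
    have hlow' : ∀ i < d, Subsingleton (Ext (ModuleCat.of R M) W i) := fun i hi ↦
      have h₁ := ih.1 i hi
      have h₃ := hlow i hi
      subsingleton_ext_X₂ hS W i
    refine ⟨hlow', ?_⟩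
    rw [Module.length_eq_add_of_exact (Ext.precompOfLinear (Ext.mk₀ (ModuleCat.ofHom f)) R W
      (zero_add d)) (Ext.precompOfLinear (Ext.mk₀ (ModuleCat.ofHom N.subtype)) R W (zero_add d))
      ?_ ?_ ?_, hlen, ih.2, Module.length_eq_add_of_exact N.subtype f N.subtype_injective hf hex,
      Module.length_eq_one_iff.2 (show IsSimpleModule R (ResidueField R) from
        isSimpleModule_iff_quot_maximal.2 ⟨_, hI, ⟨LinearEquiv.refl R _⟩⟩), add_comm]
    · rw [injective_iff_map_eq_zero]
      intro y hy
      -- In degree `d` the sequence starts with `Ext^{d-1}(N, W) = 0`, or with `0` if `d = 0`.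
      match d with
      | 0 =>
        have : Epi (ModuleCat.ofHom f) := (ModuleCat.epi_iff_surjective _).2 hf
        exact (injective_iff_map_eq_zero _).1 (Ext.precomp_mk₀_injective_of_epi W _) y hy
      | d + 1 =>
        obtain ⟨z, rfl⟩ := Ext.contravariant_sequence_exact₃ hS W y hy (add_comm 1 d)
        have := ih.1 d (by omega)
        rw [this.elim z 0, Ext.comp_zero]
    · exact fun y ↦ Ext.contravariant_sequence_exact₁ hS W y (add_comm 1 d) (hhigh.elim _ _)
    · intro y
      constructor
      · exact fun hy ↦ Ext.contravariant_sequence_exact₂ hS W y hy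
      · rintro ⟨z, rfl⟩
        have h0 : ModuleCat.ofHom N.subtype ≫ ModuleCat.ofHom f = 0 :=
          (ModuleCat.shortComplexOfCompEqZero _ _ hex.linearMap_comp_eq_zero).zero
        exact (Ext.mk₀_comp_mk₀_assoc _ _ _).trans (by rw [h0, Ext.mk₀_zero, Ext.zero_comp])

/-- Simultaneous version, for two modules, of the construction of a regular sequence from the
vanishing of `Ext^i(k, -)`. -/
lemma exists_isWeaklyRegular_of_subsingleton_ext [IsLocalRing R] [IsNoetherianRing R]
    (n : ℕ) (M W : ModuleCat.{u} R) [Module.Finite R M] [Module.Finite R W]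
    (hM : ∀ i < n, Subsingleton (Ext (ModuleCat.of R (ResidueField R)) M i))
    (hW : ∀ i < n, Subsingleton (Ext (ModuleCat.of R (ResidueField R)) W i)) :
    ∃ rs : List R, rs.length = n ∧ (∀ r ∈ rs, r ∈ maximalIdeal R) ∧
      IsWeaklyRegular M rs ∧ IsWeaklyRegular W rs := by
  induction n generalizing M W with
  | zero => exact ⟨[], rfl, by simp, .nil R _, .nil R _⟩
  | succ n ih =>
    have h₁ : Subsingleton (ResidueField R →ₗ[R] M) :=
      have := hM 0 n.succ_pos
      (Ext.addEquiv₀.trans ModuleCat.homAddEquiv :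
        Ext (ModuleCat.of R (ResidueField R)) M 0 ≃+ _).symm.subsingleton
    have h₂ : Subsingleton (ResidueField R →ₗ[R] W) :=
      have := hW 0 n.succ_pos
      (Ext.addEquiv₀.trans ModuleCat.homAddEquiv :
        Ext (ModuleCat.of R (ResidueField R)) W 0 ≃+ _).symm.subsingleton
    have h : Subsingleton (ResidueField R →ₗ[R] M × W) :=
      (LinearMap.prodEquiv R).symm.subsingleton
    obtain ⟨x, hx, hreg⟩ := IsSMulRegular.subsingleton_linearMap_iff.1 h
    have hx : x ∈ maximalIdeal R := by
      rwa [show Module.annihilator R (ResidueField R) = maximalIdeal R from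
        Ideal.annihilator_quotient] at hx
    have hMx : IsSMulRegular M x := hreg.of_injective (LinearMap.inl R M W) LinearMap.inl_injective
    have hWx : IsSMulRegular W x := hreg.of_injective (LinearMap.inr R M W) LinearMap.inr_injective
    obtain ⟨rs, hlen, hmem, hrM, hrW⟩ := ih (ModuleCat.of R (QuotSMulTop x M))
      (ModuleCat.of R (QuotSMulTop x W))
      (fun i hi ↦ subsingleton_ext_to_X₃ hMx.smulShortComplex_shortExact _ i
        (h₂ := hM i (by omega)) (h₁ := hM (i + 1) (by omega)))
      (fun i hi ↦ subsingleton_ext_to_X₃ hWx.smulShortComplex_shortExact _ i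
        (h₂ := hW i (by omega)) (h₁ := hW (i + 1) (by omega)))
    refine ⟨x :: rs, by simp [hlen], by simpa using ⟨hx, hmem⟩, ?_, ?_⟩
    · exact (isWeaklyRegular_cons_iff _ _ _).2 ⟨hMx, hrM⟩
    · exact (isWeaklyRegular_cons_iff _ _ _).2 ⟨hWx, hrW⟩

end Duality

/-! ### Reflexivity of maximal Cohen-Macaulay modules -/

section Reflexivity

open IsLocalRing RingTheory.Sequence Pointwise

variable {R : Type u} [CommRing R] [IsLocalRing R]

lemma exists_isWeaklyRegular_of_isMCM {d : ℕ} (hd : ringKrullDim R = d) {M : ModuleCat.{u} R}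
    (hM : isMCM R M) : ∃ rs : List R, d ≤ rs.length ∧ (∀ r ∈ rs, r ∈ maximalIdeal R) ∧
      IsWeaklyRegular M rs := by
  have h : (d : ℕ∞) ≤ depth R M := by
    have := hM.2
    rw [hd] at this
    exact WithBot.coe_le_coe.1 this
  match d with
  | 0 => exact ⟨[], le_rfl, by simp, .nil R _⟩
  | d + 1 =>
    have h' : (d : ℕ∞) < depth R M := lt_of_lt_of_le (by exact_mod_cast d.lt_succ_self) h
    rw [depth, lt_iSup_iff] at h'
    obtain ⟨rs, h'⟩ := h'
    rw [lt_iSup_iff] at h'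
    obtain ⟨hrs, h'⟩ := h'
    exact ⟨rs, by exact_mod_cast h', hrs.1, hrs.2⟩

lemma isMCM_of_isWeaklyRegular {M : ModuleCat.{u} R} [Module.Finite R M] (rs : List R)
    (hd : ringKrullDim R = rs.length) (hrs : ∀ r ∈ rs, r ∈ maximalIdeal R)
    (reg : IsWeaklyRegular M rs) : isMCM R M := by
  refine ⟨inferInstance, ?_⟩
  rw [hd]
  have : (rs.length : ℕ∞) ≤ depth R M := le_iSup₂_of_le rs ⟨hrs, reg⟩ le_rfl
  exact WithBot.coe_le_coe.2 this

lemma isMCM_self (hR : IsCohenMacaulayRing R) : isMCM R (ModuleCat.of R R) :=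
  ⟨inferInstanceAs (Module.Finite R R), hR.ge⟩

variable [IsNoetherianRing R]

lemma subsingleton_ext_residueField_of_isMCM {d : ℕ} (hd : ringKrullDim R = d)
    {M : ModuleCat.{u} R} [Nontrivial M] (hM : isMCM R M) (i : ℕ) (hi : i < d) :
    Subsingleton (Ext (ModuleCat.of R (ResidueField R)) M i) := by
  have := hM.1
  obtain ⟨rs, hlen, hrs, reg⟩ := exists_isWeaklyRegular_of_isMCM hd hM
  have reg' := IsRegular.of_isWeaklyRegular_of_mem_maximalIdeal M hrs reg
  refine ModuleCat.subsingleton_ext_of_exists_isRegular (maximalIdeal R)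
    (ModuleCat.of R (ResidueField R)) ?_ M ?_ rs hrs reg' i (hi.trans_le hlen)
  · rw [Module.support_eq_zeroLocus]
    exact (congrArg _ (congrArg _ Ideal.annihilator_quotient)).le
  · exact Ne.lt_top (Submodule.top_ne_ideal_smul_of_le_jacobson_annihilator
      (maximalIdeal_le_jacobson _)).symm

lemma isArtinianRing_quotient_ofList {rs : List R} (reg : IsRegular R rs)
    (hd : ringKrullDim R = rs.length) : IsArtinianRing (R ⧸ Ideal.ofList rs) := by
  have h := ringKrullDim_add_length_eq_ringKrullDim_of_isRegular rs reg
  rw [isArtinianRing_iff_isNoetherianRing_krullDimLE_zero]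
  refine ⟨inferInstance, ?_⟩
  rw [Ring.krullDimLE_iff, Nat.cast_zero]
  rw [hd] at h
  generalize ringKrullDim (R ⧸ Ideal.ofList rs) = t at h
  induction t with
  | bot => exact bot_le
  | coe t =>
    have h' : t + rs.length = (rs.length : ℕ∞) := WithBot.coe_injective h
    rw [ENat.add_left_injective_of_ne_top (ENat.natCast_ne_top rs.length)
      (h'.trans (zero_add _).symm)]
    exact le_rfl

lemma exists_residueField_injective (J : Ideal R) (hJ : J ≠ ⊤) [IsArtinianRing (R ⧸ J)] :
    ∃ f : ResidueField R →ₗ[R] R ⧸ J, Function.Injective f := by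
  have : IsArtinian R (R ⧸ J) := isArtinian_of_le_annihilator _ Ideal.annihilator_quotient.ge
  have : Nontrivial (R ⧸ J) := Ideal.Quotient.nontrivial_iff.2 hJ
  obtain ⟨S, hS⟩ := IsAtomic.exists_atom (Submodule R (R ⧸ J))
  obtain ⟨I, hI, ⟨e⟩⟩ := isSimpleModule_iff_quot_maximal.1 (isSimpleModule_iff_isAtom.2 hS)
  obtain rfl := eq_maximalIdeal hI
  exact ⟨S.subtype ∘ₗ e.symm.toLinearMap, S.subtype_injective.comp e.symm.injective⟩

/-- The duality with respect to a canonical module `Ω`: for maximal Cohen-Macaulay `M`, so is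
`Hom(M, Ω)`, and `M` is `Ω`-reflexive. A common regular sequence of length `dim R` on `R`
and `Ω` bounds the injective dimension of `Ω` by `dim R`, which makes the higher `Ext(M, Ω)`
vanish; reflexivity is then lifted from modules of finite length. -/
theorem isMCM_hom_and_bijective_applyₗ (hR : IsCohenMacaulayRing R) {Ω : ModuleCat.{u} R}
    (hΩ : IsCanonicalModule Ω) (M : ModuleCat.{u} R) (hM : isMCM R M) :
    isMCM R (ModuleCat.of R (M →ₗ[R] Ω)) ∧
      Function.Bijective (LinearMap.applyₗ : M →ₗ[R] (M →ₗ[R] Ω) →ₗ[R] Ω) := by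
  obtain ⟨d, hd, hlen⟩ := hΩ.type_one
  have := hM.1
  have := hΩ.mcm.1
  have : Nontrivial Ω := by
    by_contra h
    rw [not_nontrivial_iff_subsingleton] at h
    have h0 : Limits.IsZero Ω := ModuleCat.isZero_of_subsingleton _
    have : Subsingleton (Ext (ModuleCat.of R (ResidueField R)) Ω d) := by
      refine subsingleton_of_forall_eq 0 fun x ↦ ?_
      rw [← Ext.comp_mk₀_id x, h0.eq_of_src (𝟙 _) 0, Ext.mk₀_zero, Ext.comp_zero]
    rw [Module.length_eq_zero] at hlen
    exact zero_ne_one hlen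
  have hlow := subsingleton_ext_residueField_of_isMCM hd hΩ.mcm
  have : Nontrivial (ModuleCat.of R R) := inferInstanceAs (Nontrivial R)
  have : Module.Finite R (ModuleCat.of R R) := inferInstanceAs (Module.Finite R R)
  obtain ⟨rs, rfl, hrs, regR, regΩ⟩ := exists_isWeaklyRegular_of_subsingleton_ext d
    (ModuleCat.of R R) Ω (subsingleton_ext_residueField_of_isMCM hd (isMCM_self hR)) hlow
  have regR : IsRegular R rs := IsRegular.of_isWeaklyRegular_of_mem_maximalIdeal R hrs regR
  have := isArtinianRing_quotient_ofList regR hd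
  obtain ⟨f, hf⟩ := exists_residueField_injective (Ideal.ofList rs)
    (by simpa using regR.top_ne_smul.symm)
  have hhigh : ∀ (N : ModuleCat.{u} R) [Module.Finite R N] (i : ℕ), rs.length < i →
      Subsingleton (Ext N Ω i) :=
    fun N _ ↦ subsingleton_ext_of_length_lt Ω hΩ.finite_injDim rs regR f hf N
  have hext (i : ℕ) : Subsingleton (Ext M Ω (i + 1)) := by
    obtain ⟨ss, hlen, hss, reg⟩ := exists_isWeaklyRegular_of_isMCM hd hM
    exact subsingleton_ext_of_isWeaklyRegular Ω rs.length hhigh ss hss M reg (i + 1) (by omega)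
  have hfin (N : ModuleCat.{u} R) [Module.Finite R N]
      (hN : Ideal.ofList rs ≤ Module.annihilator R N) :=
    ext_of_isFiniteLength Ω rs.length hlow hlen
      (hhigh (ModuleCat.of R (ResidueField R)) _ (Nat.lt_succ_self _)) N
      (isFiniteLength_iff_isNoetherian_isArtinian.2
        ⟨inferInstance, isArtinian_of_le_annihilator N hN⟩)
  constructor
  · exact isMCM_of_isWeaklyRegular (M := ModuleCat.of R (M →ₗ[R] Ω)) rs hd hrs
      (isWeaklyRegular_hom rs M Ω regΩ hext)
  · exact bijective_applyₗ_of_isWeaklyRegular (J := Ideal.ofList rs) M rs hrs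
      (fun r hr ↦ Ideal.subset_span hr) Ω M regΩ
      (fun N _ hN ↦ (hfin N hN).1) (fun N _ hN ↦ (hfin N hN).2) hext LinearMap.id
      Function.surjective_id (fun φ ↦ ⟨φ, rfl⟩) le_sup_left

end Reflexivity

/-! ### Invariance of the global dimension under additive equivalences -/

section Equivalences

variable {𝒜 : Type w} [Category.{v} 𝒜] [Preadditive 𝒜]
  {ℬ : Type w} [Category.{v} ℬ] [Preadditive ℬ]

/-- Restriction along an additive equivalence takes the functor represented by `A` to the functor
represented by a preimage of `A`. -/
noncomputable def coyonedaCompIso (E : 𝒜 ⥤ ℬ) [E.Additive] [E.IsEquivalence] (A : ℬ) :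
    preadditiveCoyoneda.obj (op (E.objPreimage A)) ≅ E ⋙ preadditiveCoyoneda.obj (op A) :=
  NatIso.ofComponents
    (fun X ↦ (AddEquiv.mk' (Functor.FullyFaithful.ofFullyFaithful E).homEquiv
      (fun _ _ ↦ E.map_add)).toAddCommGrpIso)
    (fun f ↦ by
      ext g
      exact E.map_comp g f) ≪≫
  Functor.isoWhiskerLeft E (preadditiveCoyoneda.mapIso (E.objObjPreimageIso A).symm.op)

lemma isFinitelyPresented_comp (E : 𝒜 ⥤ ℬ) [E.Additive] [E.IsEquivalence] {F : LeftMod ℬ}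
    (hF : isFinitelyPresented ℬ F) :
    isFinitelyPresented 𝒜 (AdditiveFunctor.of (E ⋙ F.obj)) := by
  obtain ⟨A, B, β, π, hex, hsurj⟩ := hF
  let iA := coyonedaCompIso E A
  let iB := coyonedaCompIso E B
  have bijA (X : 𝒜) : Function.Bijective (iA.hom.app X) :=
    ConcreteCategory.bijective_of_isIso (iA.hom.app X)
  have bijB (X : 𝒜) : Function.Bijective (iB.hom.app X) :=
    ConcreteCategory.bijective_of_isIso (iB.hom.app X)
  refine ⟨E.objPreimage A, E.objPreimage B, iB.hom ≫ Functor.whiskerLeft E β ≫ iA.inv,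
    iA.hom ≫ Functor.whiskerLeft E π, fun X y ↦ ?_, fun X ↦ (hsurj _).comp (bijA X).2⟩
  refine (hex (E.obj X) (iA.hom.app X y)).trans ?_
  have key (z) : iA.hom.app X ((iB.hom ≫ Functor.whiskerLeft E β ≫ iA.inv).app X z) =
      β.app (E.obj X) (iB.hom.app X z) := by
    rw [← ConcreteCategory.comp_apply, ← NatTrans.comp_app, Category.assoc, Category.assoc,
      iA.inv_hom_id, Category.comp_id]
    rfl
  constructor
  · rintro ⟨w, hw⟩
    obtain ⟨z, rfl⟩ := (bijB X).2 w
    exact ⟨z, (bijA X).1 ((key z).trans hw)⟩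
  · rintro ⟨z, rfl⟩
    exact ⟨iB.hom.app X z, (key z).symm⟩

/-- Restriction of finitely presented modules along an additive equivalence. -/
noncomputable def restrictFP (E : 𝒜 ⥤ ℬ) [E.Additive] [E.IsEquivalence] :
    LeftFPMod ℬ ⥤ LeftFPMod 𝒜 :=
  ObjectProperty.lift _
    (ObjectProperty.lift _
      ((isFinitelyPresented ℬ).ι ⋙ ObjectProperty.ι _ ⋙
        (Functor.whiskeringLeft 𝒜 ℬ AddCommGrpCat.{v}).obj E)
      (fun F ↦ inferInstanceAs (E ⋙ F.obj.obj).Additive))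
    (fun F ↦ isFinitelyPresented_comp E F.property)

instance (E : 𝒜 ⥤ ℬ) [h : E.Additive] [E.IsEquivalence] : E.inv.Additive :=
  have : E.asEquivalence.functor.Additive := h
  E.asEquivalence.inverse_additive

/-- On underlying functors, `restrictFP E` is precomposition with `E`. -/
noncomputable def restrictFPCompForgetIso (E : 𝒜 ⥤ ℬ) [E.Additive] [E.IsEquivalence] :
    restrictFP E ⋙ (isFinitelyPresented 𝒜).ι ⋙ ObjectProperty.ι _ ≅
      (isFinitelyPresented ℬ).ι ⋙ ObjectProperty.ι _ ⋙
        (Functor.whiskeringLeft 𝒜 ℬ AddCommGrpCat.{v}).obj E :=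
  Iso.refl _

instance (E : 𝒜 ⥤ ℬ) [E.Additive] [E.IsEquivalence] : (restrictFP E).Full :=
  Functor.Full.of_comp_faithful_iso (restrictFPCompForgetIso E)

instance (E : 𝒜 ⥤ ℬ) [E.Additive] [E.IsEquivalence] : (restrictFP E).Faithful :=
  Functor.Faithful.of_comp_iso (restrictFPCompForgetIso E)

instance (E : 𝒜 ⥤ ℬ) [E.Additive] [E.IsEquivalence] : (restrictFP E).EssSurj where
  mem_essImage G :=
    ⟨(restrictFP E.inv).obj G, ⟨ObjectProperty.isoMk _ (ObjectProperty.isoMk _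
      (Functor.isoWhiskerRight E.asEquivalence.unitIso.symm G.obj.obj ≪≫
        Functor.leftUnitor G.obj.obj))⟩⟩

instance (E : 𝒜 ⥤ ℬ) [E.Additive] [E.IsEquivalence] : (restrictFP E).IsEquivalence where

/-- Restriction along an additive equivalence, followed by an isomorphism of the resolved module,
carries projective resolutions to projective resolutions. -/
noncomputable def ProjRes.restrict (E : 𝒜 ⥤ ℬ) [E.Additive] [E.IsEquivalence] {F : LeftFPMod ℬ}
    {G : LeftFPMod 𝒜} (e : (restrictFP E).obj F ≅ G) {n : ℕ} (r : ProjRes F n) : ProjRes G n where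
  P i := (restrictFP E).obj (r.P i)
  d i := (restrictFP E).map (r.d i)
  aug := (restrictFP E).map r.aug ≫ e.hom
  projective i := ((restrictFP E).asEquivalence.map_projective_iff _).2 (r.projective i)
  isZero i hi := (restrictFP E).map_isZero (r.isZero i hi)
  exact_d i X := r.exact_d i (E.obj X)
  exact_aug X y := by
    let e' := (ObjectProperty.ι _).mapIso ((ObjectProperty.ι _).mapIso e)
    have bij := ConcreteCategory.bijective_of_isIso (e'.hom.app X)
    refine Iff.trans ?_ (r.exact_aug (E.obj X) y)
    exact map_eq_zero_iff (e'.hom.app X).hom bij.1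
  surjective_aug X := by
    let e' := (ObjectProperty.ι _).mapIso ((ObjectProperty.ι _).mapIso e)
    have bij := ConcreteCategory.bijective_of_isIso (e'.hom.app X)
    exact bij.2.comp (r.surjective_aug (E.obj X))

lemma leftGlobalDim_le_of_isEquivalence (E : 𝒜 ⥤ ℬ) [E.Additive] [E.IsEquivalence] :
    leftGlobalDim 𝒜 ≤ leftGlobalDim ℬ := by
  refine iSup_le fun G ↦ ?_
  refine le_trans ?_ (le_iSup projDim ((restrictFP E).objPreimage G))
  exact le_iInf₂ fun n ⟨r⟩ ↦ iInf₂_le n ⟨r.restrict E ((restrictFP E).objObjPreimageIso G)⟩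

theorem leftGlobalDim_eq_of_isEquivalence (E : 𝒜 ⥤ ℬ) [E.Additive] [E.IsEquivalence] :
    leftGlobalDim 𝒜 = leftGlobalDim ℬ :=
  (leftGlobalDim_le_of_isEquivalence E).antisymm (leftGlobalDim_le_of_isEquivalence E.inv)

end Equivalences

/-! ### The canonical duality -/

section CanonicalDuality

variable {R : Type u} [CommRing R] [IsLocalRing R] [IsNoetherianRing R]

/-- The functor `Hom(-, Ω)` on maximal Cohen-Macaulay modules, for a canonical module `Ω`. -/
noncomputable def canonicalDual (hR : IsCohenMacaulayRing R) {Ω : ModuleCat.{u} R}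
    (hΩ : IsCanonicalModule Ω) : (MCM R)ᵒᵖ ⥤ MCM R where
  obj M := ⟨ModuleCat.of R (M.unop.obj →ₗ[R] Ω),
    (isMCM_hom_and_bijective_applyₗ hR hΩ _ M.unop.property).1⟩
  map f := ObjectProperty.homMk (ModuleCat.ofHom (LinearMap.lcomp R Ω f.unop.hom.hom))

variable (hR : IsCohenMacaulayRing R) {Ω : ModuleCat.{u} R} (hΩ : IsCanonicalModule Ω)

instance : (canonicalDual hR hΩ).Additive where
  map_add {M N f g} := by
    ext φ
    refine LinearMap.ext fun m ↦ ?_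
    exact φ.map_add _ _

instance : (canonicalDual hR hΩ).Faithful where
  map_injective {M N} f g h := by
    apply Quiver.Hom.unop_inj
    ext m
    refine (isMCM_hom_and_bijective_applyₗ hR hΩ _ M.unop.property).2.1 (LinearMap.ext fun φ ↦ ?_)
    have := congrArg (fun t ↦ t.hom.hom φ) h
    exact LinearMap.congr_fun this m

instance : (canonicalDual hR hΩ).Full where
  map_surjective {M N} g := by
    -- The preimage of `g : Hom(M, Ω) → Hom(N, Ω)` is its dual, read through biduality.
    let eM := LinearEquiv.ofBijective _ (isMCM_hom_and_bijective_applyₗ hR hΩ _ M.unop.property).2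
    let f : N.unop.obj →ₗ[R] M.unop.obj := eM.symm.toLinearMap ∘ₗ
      LinearMap.lcomp R Ω g.hom.hom ∘ₗ LinearMap.applyₗ
    refine ⟨(ObjectProperty.homMk (ModuleCat.ofHom f)).op, ?_⟩
    ext φ
    refine LinearMap.ext fun n ↦ ?_
    have := eM.apply_symm_apply (LinearMap.lcomp R Ω g.hom.hom (LinearMap.applyₗ n))
    exact LinearMap.congr_fun this φ

instance : (canonicalDual hR hΩ).EssSurj where
  mem_essImage M := ⟨op ((canonicalDual hR hΩ).obj (op M)), ⟨ObjectProperty.isoMk _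
    (LinearEquiv.ofBijective _
      (isMCM_hom_and_bijective_applyₗ hR hΩ _ M.property).2).symm.toModuleIso⟩⟩

instance : (canonicalDual hR hΩ).IsEquivalence where

end CanonicalDuality

end SeveralObjects

theorem mainTheorem7 (R : Type u) [CommRing R] [IsNoetherianRing R] [IsLocalRing R]
    (hR : SeveralObjects.IsCohenMacaulayRing R)
    (hΩ : ∃ Ω : ModuleCat.{u} R, SeveralObjects.IsCanonicalModule Ω) :
    SeveralObjects.leftGlobalDim (SeveralObjects.MCM R) =
      SeveralObjects.rightGlobalDim (SeveralObjects.MCM R) := by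
  obtain ⟨Ω, hΩ⟩ := hΩ
  exact (SeveralObjects.leftGlobalDim_eq_of_isEquivalence
    (SeveralObjects.canonicalDual hR hΩ)).symm
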